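/- \textbf{Setting.} For a graph $G=(V,E)$ on $V=\{1,\dots,p\}$ and $\lambda>0$, the ferromagnetic Ising model is the law $P_G(x)=\frac1Z\exp\big(\lambda\sum_{\{i,j\}\in E}x_ix_j\big)$ on $\{-1,1\}^p$. An active learning algorithm with at most $N$ rounds (any $N$) chooses in round $i$, possibly at random, a set $Z^{(i)}\subseteq V$ on the basis of the previous outcomes; it then observes the entries in $Z^{(i)}$ of a fresh sample from $P_G$, independent of the past, while the other entries are reported as missing. After the last round it outputs a (possibly randomized) estimate $\hat G$ of $G$ on the basis of all outcomes. It uses at most $n$ node observations if $\sum_{i=1}^N|Z^{(i)}|\le n$ with probability one. Let $L\ge1$ and let $m_1,\dots,m_L\ge2$ be integers with $\sum_{j=1}^L m_j=p$. Fix any partition of $V$ into $L$ sets of sizes $m_1,\dots,m_L$, and let $G'$ be the graph in which each of these sets is a clique and there are no other edges. Ensemble2a$(m_1,\dots,m_L)$ is the set of all graphs obtained from $G'$ by removing exactly one edge from each of the $L$ cliques. \textbf{Lemma.} Let $G$ be uniform on Ensemble2a$(m_1,\dots,m_L)$, and let $d_{\max}=\max_{j}m_j-1$. If an active learning algorithm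 that uses at most $n$ node observations has average error probability $\bar P_e=\mathbb P[\hat G\ne G]\le\delta$ (the probability being also over $G$), then \[ n\;\ge\;\frac{e^{\lambda d_{\max}}\,\log\big(d_{\max}(d_{\max}+1)\big)}{2\lambda d_{\max}e^{\lambda}}\Big(1-\delta-\frac{\log 2}{\log(d_{\max}+1)}\Big). \] -/

import Mathlib

open scoped BigOperators

noncomputable section

namespace ActiveLearning

/-! ## Ising models -/

/-- The sum of `x_i * x_j` over the edges of `G`, each edge being counted once
(its endpoints are listed in increasing order). The spins are `1` and `-1`. -/
def edgeSum {p : ℕ} (G : SimpleGraph (Fin p)) (x : Fin p → ℤˣ) : ℝ :=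
  open Classical in
  ∑ q : Fin p × Fin p,
    if q.1 < q.2 ∧ G.Adj q.1 q.2 then ((x q.1 : ℤ) : ℝ) * ((x q.2 : ℤ) : ℝ) else 0

/-- The partition function of the ferromagnetic Ising model. -/
def partitionFunction {p : ℕ} (lam : ℝ) (G : SimpleGraph (Fin p)) : ℝ :=
  ∑ x : Fin p → ℤˣ, Real.exp (lam * edgeSum G x)

/-- The Ising probability mass function. -/
def isingProb {p : ℕ} (lam : ℝ) (G : SimpleGraph (Fin p)) (x : Fin p → ℤˣ) : ℝ :=
  1 / partitionFunction lam G * Real.exp (lam * edgeSum G x)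

theorem partitionFunction_pos {p : ℕ} (lam : ℝ) (G : SimpleGraph (Fin p)) :
    0 < partitionFunction lam G :=
  Finset.sum_pos (fun _ _ => Real.exp_pos _) Finset.univ_nonempty

theorem isingProb_nonneg {p : ℕ} (lam : ℝ) (G : SimpleGraph (Fin p)) (x : Fin p → ℤˣ) :
    0 ≤ isingProb lam G x :=
  mul_nonneg (one_div_nonneg.mpr (partitionFunction_pos lam G).le) (Real.exp_pos _).le

theorem sum_isingProb {p : ℕ} (lam : ℝ) (G : SimpleGraph (Fin p)) :
    ∑ x : Fin p → ℤˣ, isingProb lam G x = 1 := by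
  unfold isingProb
  rw [← Finset.mul_sum]
  exact one_div_mul_cancel (partitionFunction_pos lam G).ne'

/-- The Ising model on `G` with inverse temperature `lam`, as a probability law. -/
def isingLaw {p : ℕ} (lam : ℝ) (G : SimpleGraph (Fin p)) : PMF (Fin p → ℤˣ) :=
  PMF.ofFintype (fun x => ENNReal.ofReal (isingProb lam G x)) (by
    rw [← ENNReal.ofReal_sum_of_nonneg (fun x _ => isingProb_nonneg lam G x),
      sum_isingProb, ENNReal.ofReal_one])

/-! ## Active learning -/

/-- The outcome of one round: a spin at each observed node, `none` at each missing one. -/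
abbrev Observation (p : ℕ) : Type := Fin p → Option ℤˣ

/-- Keep the entries of `x` in `Z`; the others are reported as missing. -/
def observe {p : ℕ} (Z : Finset (Fin p)) (x : Fin p → ℤˣ) : Observation p :=
  fun v => if v ∈ Z then some (x v) else none

/-- The number of nodes that were observed in a round. -/
def numObserved {p : ℕ} (o : Observation p) : ℕ :=
  (Finset.univ.filter fun v => (o v).isSome = true).card

/-- A (possibly randomized) active learning algorithm with at most `N` rounds on `p` nodes.
Given the outcomes of the first `k` rounds, `select k` is the law of the set of nodes to be
observed in the next round (the empty set costs nothing, so stopping early means selecting the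
empty set from then on), and `estimate` is the law of the final estimate of the graph.
Deterministic algorithms are those whose laws are all point masses. -/
structure Learner (p N : ℕ) where
  select : (k : ℕ) → (Fin k → Observation p) → PMF (Finset (Fin p))
  estimate : (Fin N → Observation p) → PMF (SimpleGraph (Fin p))

/-- The law of the outcomes of the first `k` rounds when the true graph is `G`: in each round,
the algorithm picks `Z` from the past outcomes, and sees the entries in `Z` of a fresh
sample of the Ising model, independent of the past. -/
def Learner.transcriptLaw {p N : ℕ} (A : Learner p N) (lam : ℝ) (G : SimpleGraph (Fin p)) :
    (k : ℕ) → PMF (Fin k → Observation p)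
  | 0 => PMF.pure Fin.elim0
  | k + 1 =>
      (A.transcriptLaw lam G k).bind fun h =>
        (A.select k h).bind fun Z =>
          (isingLaw lam G).map fun x => (Fin.snoc h (observe Z x) : Fin (k + 1) → Observation p)

/-- With probability one, the total number of node observations is at most `n`. -/
def Learner.WithinBudget {p N : ℕ} (A : Learner p N) (lam : ℝ) (G : SimpleGraph (Fin p))
    (n : ℕ) : Prop :=
  ∀ h ∈ (A.transcriptLaw lam G N).support, ∑ i, numObserved (h i) ≤ n

/-- The law of the estimate of the graph when the true graph is `G`. -/
def Learner.estimateLaw {p N : ℕ} (A : Learner p N) (lam : ℝ) (G : SimpleGraph (Fin p)) :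
    PMF (SimpleGraph (Fin p)) :=
  (A.transcriptLaw lam G N).bind A.estimate

/-- The probability that the estimate differs from `G`, when the true graph is `G`. -/
def Learner.errorProb {p N : ℕ} (A : Learner p N) (lam : ℝ) (G : SimpleGraph (Fin p)) : ℝ :=
  ((A.estimateLaw lam G).toOuterMeasure {H | H ≠ G}).toReal

/-- The error probability when the true graph is uniform on the class `T`. -/
def Learner.avgErrorProb {p N : ℕ} (A : Learner p N) (lam : ℝ)
    (T : Finset (SimpleGraph (Fin p))) : ℝ :=
  (∑ G ∈ T, A.errorProb lam G) / (T.card : ℝ)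

/-! ## The ensemble -/

/-- The base graph: the disjoint union of the cliques `{v | c v = j}`, where `c v` is the
index of the clique that contains `v`. -/
def cliqueUnion {p L : ℕ} (c : Fin p → Fin L) : SimpleGraph (Fin p) where
  Adj u v := u ≠ v ∧ c u = c v
  symm := ⟨fun _ _ h => ⟨h.1.symm, h.2.symm⟩⟩
  loopless := ⟨fun _ h => h.1 rfl⟩

/-- All graphs obtained from the base graph by removing a single edge from each clique: `e j`
is the edge that is removed from the `j`-th clique. -/
def ensemble2a {p L : ℕ} (c : Fin p → Fin L) : Finset (SimpleGraph (Fin p)) :=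
  open Classical in
  Finset.univ.filter fun G => ∃ e : Fin L → Sym2 (Fin p),
    (∀ j, e j ∈ (cliqueUnion c).edgeSet ∧ ∀ v ∈ e j, c v = j) ∧
      G = (cliqueUnion c).deleteEdges (Set.range e)

/-- The largest clique size minus one. -/
def dmax {L : ℕ} (m : Fin L → ℕ) : ℕ := Finset.univ.sup m - 1

end ActiveLearning

end

namespace ActiveLearning

/-! Fix a largest clique `C`, with d+1 nodes. For `G` in the ensemble let `B = G ⊔ cliqueOn C`: the
missing edge uv of `C` is put back, so `B` hides which of the M = (d+1)d/2 edges was removed. A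
successful learner must tell `G` from `B`, yet for strong coupling the spins at u and v nearly
always agree even under `G`, so the edge hardly changes the law.

Information is measured in Donsker–Varadhan form, E_G f ≤ K + log E_B e^f, which passes through
adaptive randomized rounds by Jensen (`expectation_transcriptLaw_le`). A sample admits K = 2λ
P_G(x_u ≠ x_v), and a round that shows at most one spin admits K = 0; hence each observed node costs
at most λ P_G(x_u ≠ x_v) (`expectation_observe_le`). Flattening the spins on `C` gives P_G(x_u ≠
x_v) ≤ d e^{-λ(d-1)} (`expectation_ne_le`).

The test function log(1 + (M-1) P(Ĝ = G | transcript)) yields a Fano inequality for each `G`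
(`estimateLaw_mul_log_le`). Each `B` is shared by at least M graphs, and their output probabilities
under `B` sum to at most 1. Averaging gives (1-δ) log M ≤ κn + log 2 with κ = λ d e^{-λ(d-1)}
(`one_sub_mul_log_choose_le`); the rest is arithmetic. -/

/-! ## Expectations over finite types -/

/-- The expectation of a real function under a law on a finite type. -/
noncomputable def expectation {α : Type*} [Fintype α] (μ : PMF α) (f : α → ℝ) : ℝ :=
  ∑ a, (μ a).toReal * f a

section Expectation

variable {α β : Type*} [Fintype α] [Fintype β]

theorem sum_toReal (μ : PMF α) : ∑ a, (μ a).toReal = 1 := by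
  rw [← ENNReal.toReal_sum fun a _ => μ.apply_ne_top a, ← tsum_fintype (L := .unconditional _),
    μ.tsum_coe, ENNReal.toReal_one]

theorem expectation_const (μ : PMF α) (b : ℝ) : expectation μ (fun _ => b) = b := by
  rw [expectation, ← Finset.sum_mul, sum_toReal, one_mul]

theorem expectation_add (μ : PMF α) (f g : α → ℝ) :
    expectation μ (fun a => f a + g a) = expectation μ f + expectation μ g := by
  simp only [expectation, mul_add, Finset.sum_add_distrib]

theorem expectation_sub (μ : PMF α) (f g : α → ℝ) :
    expectation μ (fun a => f a - g a) = expectation μ f - expectation μ g := by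
  simp only [expectation, mul_sub, Finset.sum_sub_distrib]

theorem expectation_mul_const (μ : PMF α) (f : α → ℝ) (b : ℝ) :
    expectation μ (fun a => f a * b) = expectation μ f * b := by
  simp only [expectation, Finset.sum_mul, mul_assoc]

theorem expectation_mono_support (μ : PMF α) {f g : α → ℝ} (h : ∀ a ∈ μ.support, f a ≤ g a) :
    expectation μ f ≤ expectation μ g := by
  refine Finset.sum_le_sum fun a _ => ?_
  by_cases ha : a ∈ μ.support
  · exact mul_le_mul_of_nonneg_left (h a ha) ENNReal.toReal_nonneg
  · rw [(μ.apply_eq_zero_iff a).2 ha]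
    simp

theorem expectation_mono (μ : PMF α) {f g : α → ℝ} (h : ∀ a, f a ≤ g a) :
    expectation μ f ≤ expectation μ g :=
  expectation_mono_support μ fun a _ => h a

theorem toReal_bind_apply {γ : Type*} (μ : PMF α) (κ : α → PMF γ) (b : γ) :
    (μ.bind κ b).toReal = expectation μ fun a => (κ a b).toReal := by
  rw [PMF.bind_apply, tsum_fintype, ENNReal.toReal_sum]
  · simp only [expectation, ENNReal.toReal_mul]
  · exact fun a _ => ENNReal.mul_ne_top (μ.apply_ne_top a) ((κ a).apply_ne_top b)

theorem expectation_bind (μ : PMF α) (κ : α → PMF β) (f : β → ℝ) :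
    expectation (μ.bind κ) f = expectation μ fun a => expectation (κ a) f := by
  simp only [expectation, toReal_bind_apply, Finset.sum_mul, Finset.mul_sum, mul_assoc]
  exact Finset.sum_comm

theorem expectation_pure (a : α) (f : α → ℝ) : expectation (PMF.pure a) f = f a := by
  classical
  rw [expectation, Finset.sum_eq_single a] <;> simp +contextual [PMF.pure_apply]

theorem expectation_map (μ : PMF α) (g : α → β) (f : β → ℝ) :
    expectation (μ.map g) f = expectation μ fun a => f (g a) := by
  rw [← PMF.bind_pure_comp, expectation_bind]
  simp only [Function.comp_apply, expectation_pure]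

theorem expectation_exp_pos (μ : PMF α) (f : α → ℝ) :
    0 < expectation μ fun a => Real.exp (f a) := by
  obtain ⟨a, ha⟩ := μ.support_nonempty
  refine Finset.sum_pos' (fun b _ => by positivity) ⟨a, Finset.mem_univ a, ?_⟩
  exact mul_pos (ENNReal.toReal_pos ((PMF.mem_support_iff _ _).1 ha) (μ.apply_ne_top a))
    (Real.exp_pos _)

/-- Jensen's inequality for the exponential. -/
theorem expectation_le_log (μ : PMF α) (f : α → ℝ) :
    expectation μ f ≤ Real.log (expectation μ fun a => Real.exp (f a)) := by
  set S := expectation μ fun a => Real.exp (f a) with hS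
  have hS0 : 0 < S := expectation_exp_pos μ f
  have h := expectation_mono μ (f := fun a => f a - (Real.log S - 1))
    (g := fun a => Real.exp (f a) * S⁻¹) fun a => by
      have := Real.add_one_le_exp (f a - Real.log S)
      rw [Real.exp_sub, Real.exp_log hS0, div_eq_mul_inv] at this
      linarith
  rw [expectation_sub, expectation_const, expectation_mul_const, ← hS,
    mul_inv_cancel₀ hS0.ne'] at h
  linarith

end Expectation

/-! ## Transcripts -/

theorem numObserved_observe {p : ℕ} (Z : Finset (Fin p)) (x : Fin p → ℤˣ) :
    numObserved (observe Z x) = Z.card := by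
  unfold numObserved observe
  congr 1
  ext v
  by_cases h : v ∈ Z <;> simp [h]

/-- If each observed node is worth at most `κ` nats of information about `G` against `B`, then
so is each node of a whole transcript. -/
theorem expectation_transcriptLaw_le {p N : ℕ} (A : Learner p N) (lam κ : ℝ)
    (G B : SimpleGraph (Fin p))
    (hround : ∀ (Z : Finset (Fin p)) (f : Observation p → ℝ),
      expectation (isingLaw lam G) (fun x => f (observe Z x)) ≤ κ * Z.card +
        Real.log (expectation (isingLaw lam B) fun x => Real.exp (f (observe Z x))))
    (k : ℕ) (f : (Fin k → Observation p) → ℝ) :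
    expectation (A.transcriptLaw lam G k)
        (fun h => f h - κ * ((∑ i, numObserved (h i) : ℕ) : ℝ)) ≤
      Real.log (expectation (A.transcriptLaw lam B k) fun h => Real.exp (f h)) := by
  induction k with
  | zero => simp [Learner.transcriptLaw, expectation_pure]
  | succ k ih =>
    simp only [Learner.transcriptLaw, expectation_bind, expectation_map]
    -- exp `F` is the conditional expectation of exp `f` under `B` given the first `k` rounds, so
    -- `ih F` already has the desired right-hand side.
    set F : (Fin k → Observation p) → ℝ := fun h =>
      Real.log (expectation (A.select k h) fun Z => expectation (isingLaw lam B) fun x =>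
        Real.exp (f (Fin.snoc (α := fun _ => Observation p) h (observe Z x)))) with hF
    have hexp (Z : Finset (Fin p)) (h : Fin k → Observation p) :
        0 < expectation (isingLaw lam B) fun x =>
          Real.exp (f (Fin.snoc (α := fun _ => Observation p) h (observe Z x))) :=
      expectation_exp_pos _ _
    have hexpF (h : Fin k → Observation p) : Real.exp (F h) =
        expectation (A.select k h) fun Z => expectation (isingLaw lam B) fun x =>
          Real.exp (f (Fin.snoc (α := fun _ => Observation p) h (observe Z x))) := by
      refine Real.exp_log ?_
      have := expectation_exp_pos (A.select k h) fun Z => Real.log (expectation (isingLaw lam B)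
        fun x => Real.exp (f (Fin.snoc (α := fun _ => Observation p) h (observe Z x))))
      simpa only [Real.exp_log (hexp _ h)] using this
    refine le_trans ?_ ((ih F).trans_eq (by simp only [hexpF]))
    refine expectation_mono _ fun h => ?_
    -- The set `Z` has the same conditional law under `G` and `B`, so its randomness costs only
    -- Jensen and no information.
    have hlog : expectation (A.select k h) (fun Z => Real.log (expectation (isingLaw lam B) fun x =>
        Real.exp (f (Fin.snoc (α := fun _ => Observation p) h (observe Z x))))) ≤ F h := by
      refine (expectation_le_log _ _).trans_eq ?_
      simp only [Real.exp_log (hexp _ h), hF]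
    rw [← expectation_const (A.select k h) (κ * ((∑ i, numObserved (h i) : ℕ) : ℝ))]
    refine le_trans ?_ (sub_le_sub_right hlog _)
    rw [← expectation_sub]
    refine expectation_mono _ fun Z => ?_
    have hZ := hround Z fun o => f (Fin.snoc (α := fun _ => Observation p) h o)
    simp only [Fin.sum_univ_castSucc, Fin.snoc_castSucc, Fin.snoc_last, numObserved_observe]
    rw [expectation_sub, expectation_const]
    push_cast
    linarith

/-! ## Ising laws -/

theorem isingLaw_toReal {p : ℕ} (lam : ℝ) (G : SimpleGraph (Fin p)) (x : Fin p → ℤˣ) :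
    (isingLaw lam G x).toReal = isingProb lam G x := by
  simp [isingLaw, ENNReal.toReal_ofReal (isingProb_nonneg lam G x)]

theorem expectation_isingLaw {p : ℕ} (lam : ℝ) (G : SimpleGraph (Fin p))
    (f : (Fin p → ℤˣ) → ℝ) :
    expectation (isingLaw lam G) f = ∑ x, isingProb lam G x * f x := by
  simp only [expectation, isingLaw_toReal]

theorem isingProb_neg {p : ℕ} (lam : ℝ) (G : SimpleGraph (Fin p)) (x : Fin p → ℤˣ) :
    isingProb lam G (-x) = isingProb lam G x := by
  simp [isingProb, edgeSum]

theorem expectation_isingLaw_neg {p : ℕ} (lam : ℝ) (G : SimpleGraph (Fin p))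
    (f : (Fin p → ℤˣ) → ℝ) :
    expectation (isingLaw lam G) (fun x => f (-x)) = expectation (isingLaw lam G) f := by
  simp only [expectation_isingLaw]
  refine Fintype.sum_equiv (Equiv.neg _) _ _ fun x => ?_
  simp [isingProb_neg]

/-- A single spin is uniform under every Ising law. -/
theorem expectation_isingLaw_spin {p : ℕ} (lam : ℝ) (G : SimpleGraph (Fin p)) (v : Fin p)
    (f : ℤˣ → ℝ) :
    expectation (isingLaw lam G) (fun x => f (x v)) = (f 1 + f (-1)) / 2 := by
  have h1 := expectation_isingLaw_neg lam G fun x => f (x v)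
  have h2 : expectation (isingLaw lam G) (fun x => f (x v) + f ((-x) v)) = f 1 + f (-1) := by
    rw [← expectation_const (isingLaw lam G) (f 1 + f (-1))]
    congr 1
    ext x
    rcases Int.units_eq_one_or (x v) with h | h <;> simp [h, add_comm]
  rw [expectation_add, h1] at h2
  linarith

/-- By the global spin flip symmetry, a lone spin is a fair coin for every graph, so such a round is
uninformative. -/
theorem expectation_isingLaw_observe_eq {p : ℕ} (lam : ℝ) (G B : SimpleGraph (Fin p))
    {Z : Finset (Fin p)} (hZ : Z.card ≤ 1) (f : Observation p → ℝ) :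
    expectation (isingLaw lam G) (fun x => f (observe Z x)) =
      expectation (isingLaw lam B) fun x => f (observe Z x) := by
  rcases Nat.le_one_iff_eq_zero_or_eq_one.1 hZ with h | h
  · have (x : Fin p → ℤˣ) : observe Z x = fun _ => none := by
      ext1 w
      simp [observe, Finset.card_eq_zero.1 h]
    simp only [this, expectation_const]
  · obtain ⟨v, rfl⟩ := Finset.card_eq_one.1 h
    have (x : Fin p → ℤˣ) : observe {v} x = observe {v} fun _ => x v := by
      ext1 w
      by_cases hw : w = v <;> simp [observe, hw]
    have h (H : SimpleGraph (Fin p)) := expectation_isingLaw_spin lam H v fun s =>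
      f (observe {v} fun _ => s)
    have heq : (fun x : Fin p → ℤˣ => f (observe {v} x)) = fun x => f (observe {v} fun _ => x v) :=
      funext fun x => congrArg f (this x)
    rw [heq, h, h]

/-- The variational bound on the information in a sample, when `B` is `G` with the additional
edge between `u` and `v`. -/
theorem expectation_isingLaw_le {p : ℕ} {lam : ℝ} (hlam : 0 ≤ lam) {G B : SimpleGraph (Fin p)}
    {u v : Fin p}
    (hGB : ∀ x, edgeSum B x = edgeSum G x + ((x u : ℤ) : ℝ) * ((x v : ℤ) : ℝ))
    (f : (Fin p → ℤˣ) → ℝ) :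
    expectation (isingLaw lam G) f ≤
      2 * lam * expectation (isingLaw lam G) (fun x => if x u = x v then 0 else 1) +
        Real.log (expectation (isingLaw lam B) fun x => Real.exp (f x)) := by
  have hspin (x : Fin p → ℤˣ) : ((x u : ℤ) : ℝ) * ((x v : ℤ) : ℝ) =
      1 - 2 * (if x u = x v then 0 else 1) := by
    rcases Int.units_eq_one_or (x u) with h | h <;>
      rcases Int.units_eq_one_or (x v) with h' | h' <;> norm_num [h, h']
  have hZ : partitionFunction lam B ≤ Real.exp lam * partitionFunction lam G := by
    rw [partitionFunction, partitionFunction, Finset.mul_sum]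
    refine Finset.sum_le_sum fun x _ => ?_
    rw [← Real.exp_add, Real.exp_le_exp, hGB, hspin]
    split_ifs <;> nlinarith
  have hG := partitionFunction_pos lam G
  have hB := partitionFunction_pos lam B
  -- Pointwise P_G e^{-2λ·1[x_u ≠ x_v]} ≤ P_B: the density of P_B against P_G is e^{λ x_u x_v}
  -- Z_G/Z_B, and Z_B ≤ e^λ Z_G.
  have hle : expectation (isingLaw lam G)
      (fun x => Real.exp (f x - (if x u = x v then 0 else 1) * (2 * lam))) ≤
        expectation (isingLaw lam B) fun x => Real.exp (f x) := by
    simp only [expectation_isingLaw]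
    refine Finset.sum_le_sum fun x _ => ?_
    have hx : Real.exp (lam * edgeSum G x) *
        Real.exp (f x - (if x u = x v then 0 else 1) * (2 * lam)) =
          (Real.exp (lam * edgeSum B x) * Real.exp (f x)) / Real.exp lam := by
      rw [← Real.exp_add, ← Real.exp_add, ← Real.exp_sub, hGB, hspin]
      congr 1
      ring
    rw [isingProb, isingProb, mul_assoc, mul_assoc, hx, one_div_mul_eq_div, one_div_mul_eq_div,
      div_div]
    exact div_le_div_of_nonneg_left (by positivity) hB hZ
  have h := (expectation_le_log (isingLaw lam G) _).trans
    (Real.log_le_log (expectation_exp_pos _ _) hle)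
  rw [expectation_sub, expectation_mul_const] at h
  linarith

/-- An informative round shows at least two nodes, so the cost 2λ P_G(x_u ≠ x_v) of a sample, shared
among them, loses its factor 2. -/
theorem expectation_observe_le {p : ℕ} {lam κ : ℝ} (hlam : 0 ≤ lam) {G B : SimpleGraph (Fin p)}
    {u v : Fin p}
    (hGB : ∀ x, edgeSum B x = edgeSum G x + ((x u : ℤ) : ℝ) * ((x v : ℤ) : ℝ))
    (hκ : lam * expectation (isingLaw lam G) (fun x => if x u = x v then 0 else 1) ≤ κ)
    (Z : Finset (Fin p)) (f : Observation p → ℝ) :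
    expectation (isingLaw lam G) (fun x => f (observe Z x)) ≤ κ * Z.card +
      Real.log (expectation (isingLaw lam B) fun x => Real.exp (f (observe Z x))) := by
  have hκ0 : 0 ≤ κ := by
    refine le_trans (mul_nonneg hlam ?_) hκ
    refine (expectation_const (isingLaw lam G) 0).symm.trans_le (expectation_mono _ fun x => ?_)
    split_ifs <;> norm_num
  rcases le_or_gt Z.card 1 with hZ | hZ
  · rw [expectation_isingLaw_observe_eq lam G B hZ]
    have := expectation_le_log (isingLaw lam B) fun x => f (observe Z x)
    have : 0 ≤ κ * Z.card := by positivity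
    linarith
  · have h := expectation_isingLaw_le hlam hGB fun x => f (observe Z x)
    have hZ' : (2 : ℝ) ≤ Z.card := by exact_mod_cast hZ
    nlinarith

/-! ## Two nodes of a clique without their edge -/

theorem edgeSum_eq_add {p : ℕ} {G B : SimpleGraph (Fin p)} {u v : Fin p} (huv : u ≠ v)
    (hG : ¬ G.Adj u v) (hB : ∀ a b, B.Adj a b ↔ G.Adj a b ∨ s(a, b) = s(u, v))
    (x : Fin p → ℤˣ) :
    edgeSum B x = edgeSum G x + ((x u : ℤ) : ℝ) * ((x v : ℤ) : ℝ) := by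
  classical
  wlog h : u < v generalizing u v
  · rw [mul_comm]
    refine this huv.symm (fun h => hG h.symm) (fun a b => ?_)
      (lt_of_le_of_ne (not_lt.1 h) huv.symm)
    rw [hB, Sym2.eq_swap (a := u)]
  have hsum : ((x u : ℤ) : ℝ) * ((x v : ℤ) : ℝ) = ∑ q : Fin p × Fin p,
      if q = (u, v) then ((x q.1 : ℤ) : ℝ) * ((x q.2 : ℤ) : ℝ) else 0 := by simp
  unfold edgeSum
  rw [hsum, ← Finset.sum_add_distrib]
  refine Finset.sum_congr rfl fun q _ => ?_
  obtain ⟨a, b⟩ := q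
  by_cases hab : (a, b) = (u, v)
  · obtain ⟨rfl, rfl⟩ := Prod.mk.inj hab
    simp [h, hG, hB]
  · have : a < b → s(a, b) ≠ s(u, v) := by
      rintro hlt he
      rcases Sym2.eq_iff.1 he with ⟨rfl, rfl⟩ | ⟨rfl, rfl⟩
      · exact hab rfl
      · exact lt_asymm h hlt
    by_cases hlt : a < b
    · simp [hab, hlt, hB, this hlt]
    · simp [hab, hlt]

/-- Symmetrizing removes the order condition, so that edge sums can be compared pair by pair. -/
theorem two_mul_edgeSum {p : ℕ} (G : SimpleGraph (Fin p)) (x : Fin p → ℤˣ) [DecidableRel G.Adj] :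
    2 * edgeSum G x =
      ∑ a, ∑ b, if G.Adj a b then ((x a : ℤ) : ℝ) * ((x b : ℤ) : ℝ) else 0 := by
  classical
  have h1 : edgeSum G x = ∑ a, ∑ b,
      if a < b ∧ G.Adj a b then ((x a : ℤ) : ℝ) * ((x b : ℤ) : ℝ) else 0 := by
    rw [edgeSum, Fintype.sum_prod_type]
    congr! 5
  have h2 : edgeSum G x = ∑ a, ∑ b,
      if b < a ∧ G.Adj a b then ((x a : ℤ) : ℝ) * ((x b : ℤ) : ℝ) else 0 := by
    rw [h1, Finset.sum_comm]
    simp only [G.adj_comm, mul_comm]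
  rw [two_mul]
  nth_rw 1 [h1]
  rw [h2, ← Finset.sum_add_distrib]
  refine Finset.sum_congr rfl fun a _ => ?_
  rw [← Finset.sum_add_distrib]
  refine Finset.sum_congr rfl fun b _ => ?_
  rcases lt_trichotomy a b with h | rfl | h
  · simp [h, h.not_gt]
  · simp
  · simp [h, h.not_gt]

/-- Making all spins of a clique (without the edge between `u` and `v`) equal to that at `u`
increases the sum over the edges by at least twice the number of edges that were cut. -/
theorem edgeSum_add_le {p : ℕ} {G : SimpleGraph (Fin p)} {C : Finset (Fin p)} {u v : Fin p}
    (hu : u ∈ C) (hv : v ∈ C)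
    (hout : ∀ a b, G.Adj a b → (a ∈ C ↔ b ∈ C))
    (hin : ∀ a ∈ C, ∀ b ∈ C, a ≠ b → s(a, b) ≠ s(u, v) → G.Adj a b)
    {x : Fin p → ℤˣ} (hx : x u ≠ x v) :
    edgeSum G x + 2 * (((C.filter fun a => x a ≠ x u).card : ℝ) *
        ((C.filter fun a => x a = x u).card : ℝ) - 1) ≤
      edgeSum G fun a => if a ∈ C then x u else x a := by
  classical
  set z : Fin p → ℤˣ := fun a => if a ∈ C then x u else x a with hz
  set F := C.filter fun a => x a ≠ x u with hF
  set H := C.filter fun a => x a = x u with hH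
  -- The cut edges, oriented from `F` to `H`; the pair (v, u) is erased because its edge is missing.
  set D := (F ×ˢ H).erase (v, u) with hD
  have hvu : (v, u) ∈ F ×ˢ H := by simp [hF, hH, hu, hv, hx.symm]
  have hcard : (D.card : ℝ) = (F.card : ℝ) * (H.card : ℝ) - 1 := by
    rw [hD, Finset.cast_card_erase_of_mem hvu, Finset.card_product]
    push_cast
    ring
  have h1 : (D.card : ℝ) = ∑ a, ∑ b, if (a, b) ∈ D then 1 else 0 := by
    rw [← Fintype.sum_prod_type' (f := fun a b => if (a, b) ∈ D then (1 : ℝ) else 0)]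
    simp
  have h2 : (D.card : ℝ) = ∑ a, ∑ b, if (b, a) ∈ D then 1 else 0 := by
    rw [h1, Finset.sum_comm]
  have hterm (a b : Fin p) : (if G.Adj a b then ((x a : ℤ) : ℝ) * ((x b : ℤ) : ℝ) else 0) +
      2 * ((if (a, b) ∈ D then 1 else 0) + (if (b, a) ∈ D then 1 else 0)) ≤
        if G.Adj a b then ((z a : ℤ) : ℝ) * ((z b : ℤ) : ℝ) else 0 := by
    have hDmem (a b : Fin p) : (a, b) ∈ D ↔
        ¬ (a = v ∧ b = u) ∧ (a ∈ C ∧ x a ≠ x u) ∧ b ∈ C ∧ x b = x u := by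
      simp [hD, hF, hH]
    have hadj (a b : Fin p) (h : (a, b) ∈ D) : G.Adj a b := by
      rw [hDmem] at h
      obtain ⟨h1, ⟨h2, h3⟩, h4, h5⟩ := h
      refine hin a h2 b h4 (fun h => h3 (h ▸ h5)) fun he => ?_
      rcases Sym2.eq_iff.1 he with ⟨rfl, rfl⟩ | h
      · exact h3 rfl
      · exact h1 h
    by_cases hab : G.Adj a b
    · rw [if_pos hab, if_pos hab]
      by_cases ha : a ∈ C
      · have hb : b ∈ C := (hout a b hab).1 ha
        have hza : z a = x u := by simp [hz, ha]
        have hzb : z b = x u := by simp [hz, hb]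
        rw [hza, hzb]
        simp only [hDmem, ha, hb, true_and]
        rcases Int.units_eq_one_or (x u) with h0 | h0 <;>
          rcases Int.units_eq_one_or (x a) with h | h <;>
            rcases Int.units_eq_one_or (x b) with h' | h' <;>
              norm_num [h0, h, h'] <;> split_ifs <;> norm_num
      · have hb : b ∉ C := fun hb => ha ((hout a b hab).2 hb)
        simp [hDmem, ha, hb, hz]
    · have h1 : (a, b) ∉ D := fun h => hab (hadj a b h)
      have h2 : (b, a) ∉ D := fun h => hab (hadj b a h).symm
      simp [hab, h1, h2]
  have hsum := Finset.sum_le_sum fun a (_ : a ∈ Finset.univ) =>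
    Finset.sum_le_sum fun b (_ : b ∈ Finset.univ) => hterm a b
  simp only [Finset.sum_add_distrib, ← Finset.mul_sum] at hsum
  rw [← two_mul_edgeSum, ← two_mul_edgeSum, ← h1, ← h2, hcard] at hsum
  linarith

/-- Since 2ik ≥ (i+k) min(i,k), the left side is at most α^{2+min(i,k)} with α = e^{-λ(i+k)}.
Replacing the minimum by a sum of two powers prepares for the binomial theorem. -/
theorem exp_neg_cut_le {lam : ℝ} (hlam : 0 ≤ lam) (i k : ℕ) :
    Real.exp (-(2 * lam * ((i + 1) * (k + 1) - 1))) ≤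
      Real.exp (-(lam * (i + k : ℕ))) ^ 2 * (Real.exp (-(lam * (i + k : ℕ))) ^ i +
        Real.exp (-(lam * (i + k : ℕ))) ^ k) := by
  rw [mul_add (Real.exp _ ^ 2), ← pow_add, ← pow_add, ← Real.exp_nat_mul, ← Real.exp_nat_mul]
  push_cast
  rcases le_total i k with h | h
  · refine le_trans (Real.exp_le_exp.2 ?_) (le_add_of_nonneg_right (Real.exp_pos _).le)
    have h' : (i : ℝ) ≤ k := by exact_mod_cast h
    nlinarith [mul_nonneg hlam (mul_nonneg (Nat.cast_nonneg (α := ℝ) i) (sub_nonneg.2 h'))]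
  · refine le_trans (Real.exp_le_exp.2 ?_) (le_add_of_nonneg_left (Real.exp_pos _).le)
    have h' : (k : ℝ) ≤ i := by exact_mod_cast h
    nlinarith [mul_nonneg hlam (mul_nonneg (Nat.cast_nonneg (α := ℝ) k) (sub_nonneg.2 h'))]

/-- A Peierls argument: encode x by its flattening on `C` and the set of nodes other than u, v that
disagree with u. The flattenings contribute at most the partition function, the sets a binomial sum.
-/
theorem sum_exp_ne_le {p : ℕ} {lam : ℝ} (hlam : 0 ≤ lam) {G : SimpleGraph (Fin p)}
    {C : Finset (Fin p)} {u v : Fin p} (huv : u ≠ v) (hu : u ∈ C) (hv : v ∈ C)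
    (hout : ∀ a b, G.Adj a b → (a ∈ C ↔ b ∈ C))
    (hin : ∀ a ∈ C, ∀ b ∈ C, a ≠ b → s(a, b) ≠ s(u, v) → G.Adj a b)
    {r : ℕ} (hr : C.card = r + 2) :
    ∑ x : Fin p → ℤˣ with x u ≠ x v, Real.exp (lam * edgeSum G x) ≤
      2 * Real.exp (-(lam * r)) ^ 2 * (1 + Real.exp (-(lam * r))) ^ r *
        partitionFunction lam G := by
  classical
  set R := (C.erase u).erase v with hR
  set α := Real.exp (-(lam * r)) with hα
  have hα0 : 0 ≤ α := (Real.exp_pos _).le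
  have hRcard : R.card = r := by
    rw [hR, Finset.card_erase_of_mem (by simp [huv.symm, hv]), Finset.card_erase_of_mem hu, hr]
    rfl
  set g : (Fin p → ℤˣ) → (Fin p → ℤˣ) × Finset (Fin p) := fun x =>
    (fun a => if a ∈ C then x u else x a, R.filter fun a => x a ≠ x u) with hg
  set ψ : (Fin p → ℤˣ) × Finset (Fin p) → ℝ := fun w =>
    Real.exp (lam * edgeSum G w.1) * (α ^ 2 * (α ^ w.2.card + α ^ (r - w.2.card))) with hψ
  have hterm (x : Fin p → ℤˣ) (hx : x u ≠ x v) : Real.exp (lam * edgeSum G x) ≤ ψ (g x) := by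
    set i := (R.filter fun a => x a ≠ x u).card with hi
    have hF : (C.filter fun a => x a ≠ x u).card = i + 1 := by
      have : C.filter (fun a => x a ≠ x u) = insert v (R.filter fun a => x a ≠ x u) := by
        ext a
        simp only [hR, Finset.mem_filter, Finset.mem_insert, Finset.mem_erase]
        constructor
        · rintro ⟨h1, h2⟩
          by_cases hav : a = v
          · exact Or.inl hav
          · exact Or.inr ⟨⟨hav, fun h => h2 (h ▸ rfl), h1⟩, h2⟩
        · rintro (rfl | h)
          · exact ⟨hv, hx.symm⟩
          · exact ⟨h.1.2.2, h.2⟩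
      rw [this, Finset.card_insert_of_notMem (by simp [hR])]
    have hir : i ≤ r := hRcard ▸ Finset.card_filter_le _ _
    have hH : (C.filter fun a => x a = x u).card = r - i + 1 := by
      have := Finset.card_filter_add_card_filter_not (s := C) fun a => x a = x u
      simp only [← ne_eq] at this
      omega
    have hedge := edgeSum_add_le hu hv hout hin hx
    have hexp := exp_neg_cut_le hlam i (r - i)
    rw [Nat.add_sub_cancel' hir, ← hα] at hexp
    rw [hF, hH] at hedge
    push_cast at hedge
    refine le_trans ?_ (mul_le_mul_of_nonneg_left hexp (Real.exp_pos _).le)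
    rw [← Real.exp_add, Real.exp_le_exp]
    nlinarith [mul_le_mul_of_nonneg_left hedge hlam]
  -- With two spin values, disagreeing with x u determines a spin; v need not be recorded because it
  -- always disagrees.
  have hinj : Set.InjOn g {x | x u ≠ x v} := by
    intro x hx y hy hxy
    obtain ⟨h1, h2⟩ := Prod.mk.inj hxy
    have hxyu : x u = y u := by simpa [hu] using congrFun h1 u
    ext1 a
    by_cases haC : a ∈ C
    · have two (s t w : ℤˣ) (hs : s ≠ w) (ht : t ≠ w) : s = t := by
        rcases Int.units_eq_one_or s with rfl | rfl <;>
          rcases Int.units_eq_one_or t with rfl | rfl <;>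
            rcases Int.units_eq_one_or w with rfl | rfl <;> simp_all
      by_cases hau : a = u
      · rw [hau, hxyu]
      by_cases hav : a = v
      · rw [hav]
        exact two _ _ (x u) (Ne.symm hx) (hxyu ▸ Ne.symm hy)
      have haR : a ∈ R := by simp [hR, hau, hav, haC]
      have h3 : x a ≠ x u ↔ y a ≠ y u := by
        have := Finset.ext_iff.1 h2 a
        simpa only [Finset.mem_filter, haR, true_and] using this
      by_cases hxa : x a = x u
      · have : y a = y u := not_not.1 fun h => h3.2 h hxa
        rw [hxa, this, hxyu]
      · exact two _ _ (x u) hxa (hxyu ▸ h3.1 hxa)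
    · simpa [haC] using congrFun h1 a
  have hψ0 (w) : 0 ≤ ψ w := by positivity
  have hbinom : ∑ S ∈ R.powerset, (α ^ S.card + α ^ (r - S.card)) = 2 * (1 + α) ^ r := by
    have h1 := Finset.sum_pow_mul_eq_add_pow α 1 R
    have h2 := Finset.sum_pow_mul_eq_add_pow 1 α R
    simp only [one_pow, mul_one, one_mul, hRcard] at h1 h2
    rw [Finset.sum_add_distrib, h1, h2, add_comm α 1, two_mul]
  calc ∑ x : Fin p → ℤˣ with x u ≠ x v, Real.exp (lam * edgeSum G x)
      ≤ ∑ x : Fin p → ℤˣ with x u ≠ x v, ψ (g x) :=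
        Finset.sum_le_sum fun x hx => hterm x (Finset.mem_filter.1 hx).2
    _ = ∑ w ∈ (Finset.univ.filter fun x : Fin p → ℤˣ => x u ≠ x v).image g, ψ w := by
        rw [Finset.sum_image]
        simpa using hinj
    _ ≤ ∑ w ∈ Finset.univ ×ˢ R.powerset, ψ w := by
        refine Finset.sum_le_sum_of_subset_of_nonneg ?_ fun w _ _ => hψ0 w
        intro w hw
        obtain ⟨x, -, rfl⟩ := Finset.mem_image.1 hw
        simp [hg, Finset.filter_subset]
    _ = _ := by
        rw [Finset.sum_product]
        simp only [hψ, ← Finset.mul_sum, hbinom]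
        rw [← Finset.sum_mul, partitionFunction]
        ring

/-- For r ≥ 2, (1+α)^r ≤ e < 3 and 2α ≤ 2/3. Assuming `h1` loses nothing: otherwise (r+1)α trivially
bounds a probability. -/
theorem two_mul_mul_one_add_pow_le {r : ℕ} (hr : 1 ≤ r) {α : ℝ} (h0 : 0 ≤ α)
    (h1 : (r + 1) * α ≤ 1) : 2 * α * (1 + α) ^ r ≤ r + 1 := by
  rcases hr.eq_or_lt with rfl | hr
  · norm_num at h1 ⊢
    nlinarith
  · have hr' : (2 : ℝ) ≤ r := by exact_mod_cast hr
    have hpow : (1 + α) ^ r ≤ Real.exp 1 := by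
      calc (1 + α) ^ r ≤ Real.exp α ^ r := by
            gcongr
            linarith [Real.add_one_le_exp α]
        _ = Real.exp (r * α) := (Real.exp_nat_mul α r).symm
        _ ≤ Real.exp 1 := Real.exp_le_exp.2 (by linarith)
    have he := Real.exp_one_lt_d9
    have hα : 2 * α ≤ 2 / 3 := by nlinarith
    have : 2 * α * (1 + α) ^ r ≤ 2 / 3 * 3 :=
      mul_le_mul hα (by linarith) (by positivity) (by norm_num)
    linarith

theorem expectation_ne_le {p : ℕ} {lam : ℝ} (hlam : 0 ≤ lam) {G : SimpleGraph (Fin p)}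
    {C : Finset (Fin p)} {u v : Fin p} (huv : u ≠ v) (hu : u ∈ C) (hv : v ∈ C)
    (hout : ∀ a b, G.Adj a b → (a ∈ C ↔ b ∈ C))
    (hin : ∀ a ∈ C, ∀ b ∈ C, a ≠ b → s(a, b) ≠ s(u, v) → G.Adj a b)
    {r : ℕ} (hr1 : 1 ≤ r) (hr : C.card = r + 2) :
    expectation (isingLaw lam G) (fun x => if x u = x v then 0 else 1) ≤
      (r + 1) * Real.exp (-(lam * r)) := by
  have hα := Real.exp_pos (-(lam * r))
  rcases le_or_gt 1 ((r + 1) * Real.exp (-(lam * r))) with h | h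
  · refine le_trans ?_ h
    refine (expectation_mono _ fun x => ?_).trans_eq (expectation_const (isingLaw lam G) 1)
    split_ifs <;> norm_num
  · have hZ := partitionFunction_pos lam G
    have hsum := sum_exp_ne_le hlam huv hu hv hout hin hr
    have heq : expectation (isingLaw lam G) (fun x => if x u = x v then 0 else 1) =
        1 / partitionFunction lam G *
          ∑ x : Fin p → ℤˣ with x u ≠ x v, Real.exp (lam * edgeSum G x) := by
      rw [expectation_isingLaw, Finset.mul_sum, Finset.sum_filter]
      refine Finset.sum_congr rfl fun x _ => ?_
      by_cases hx : x u = x v <;> simp [hx, isingProb]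
    rw [heq, one_div_mul_eq_div, div_le_iff₀ hZ]
    refine hsum.trans (mul_le_mul_of_nonneg_right ?_ hZ.le)
    have := mul_le_mul_of_nonneg_left (two_mul_mul_one_add_pow_le hr1 hα.le h.le) hα.le
    linarith

/-! ## Fano's inequality for one graph -/

theorem errorProb_eq {p N : ℕ} (A : Learner p N) (lam : ℝ) (G : SimpleGraph (Fin p)) :
    A.errorProb lam G = 1 - (A.estimateLaw lam G G).toReal := by
  classical
  set μ := A.estimateLaw lam G with hμ
  have h : μ.toOuterMeasure {H | H ≠ G} + μ G = 1 := by
    rw [← PMF.toOuterMeasure_apply_singleton, PMF.toOuterMeasure_apply, PMF.toOuterMeasure_apply,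
      ← ENNReal.tsum_add, ← μ.tsum_coe]
    refine tsum_congr fun H => ?_
    by_cases hH : H = G <;> simp [hH]
  have htop : μ.toOuterMeasure {H | H ≠ G} ≠ ⊤ :=
    ne_top_of_le_ne_top ENNReal.one_ne_top (h ▸ le_self_add)
  have h' := congrArg ENNReal.toReal h
  rw [ENNReal.toReal_add htop (μ.apply_ne_top G), ENNReal.toReal_one] at h'
  rw [Learner.errorProb, ← hμ]
  linarith

/-- Bernoulli's inequality M^s ≤ 1 + s(M-1); it handles a randomized estimate. -/
theorem mul_log_le_log_one_add {s M : ℝ} (hs0 : 0 ≤ s) (hs1 : s ≤ 1) (hM : 1 ≤ M) :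
    s * Real.log M ≤ Real.log (1 + s * (M - 1)) := by
  have h := rpow_one_add_le_one_add_mul_self (s := M - 1) (by linarith) hs0 hs1
  rw [add_sub_cancel] at h
  rw [← Real.log_rpow (by linarith)]
  exact Real.log_le_log (Real.rpow_pos_of_pos (by linarith) _) h

theorem toReal_apply_le_one {α : Type*} (μ : PMF α) (a : α) : (μ a).toReal ≤ 1 := by
  simpa using ENNReal.toReal_mono ENNReal.one_ne_top (μ.coe_le_one a)

/-- Fano's inequality, comparing the law of the estimate under `G` with that under `B`. -/
theorem estimateLaw_mul_log_le {p N n : ℕ} (A : Learner p N) {lam κ M : ℝ} (hκ : 0 ≤ κ)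
    (hM : 1 ≤ M) {G B : SimpleGraph (Fin p)}
    (hround : ∀ (Z : Finset (Fin p)) (f : Observation p → ℝ),
      expectation (isingLaw lam G) (fun x => f (observe Z x)) ≤ κ * Z.card +
        Real.log (expectation (isingLaw lam B) fun x => Real.exp (f (observe Z x))))
    (hA : A.WithinBudget lam G n) :
    (A.estimateLaw lam G G).toReal * Real.log M ≤
      κ * n + Real.log 2 + ((A.estimateLaw lam B G).toReal * (M - 1) - 1) / 2 := by
  have hpos (h) : 0 < 1 + (A.estimate h G).toReal * (M - 1) :=
    add_pos_of_pos_of_nonneg one_pos (mul_nonneg ENNReal.toReal_nonneg (by linarith))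
  have h1 := expectation_transcriptLaw_le A lam κ G B hround N
    fun h => Real.log (1 + (A.estimate h G).toReal * (M - 1))
  simp only [Real.exp_log (hpos _)] at h1
  rw [expectation_add, expectation_const, expectation_mul_const, ← toReal_bind_apply] at h1
  have h2 : expectation (A.transcriptLaw lam G N)
      (fun h => (A.estimate h G).toReal * Real.log M - κ * n) ≤
        expectation (A.transcriptLaw lam G N) fun h =>
          Real.log (1 + (A.estimate h G).toReal * (M - 1)) -
            κ * ((∑ i, numObserved (h i) : ℕ) : ℝ) := by
    refine expectation_mono_support _ fun h hh => sub_le_sub ?_ ?_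
    · exact mul_log_le_log_one_add ENNReal.toReal_nonneg (toReal_apply_le_one _ _) hM
    · exact mul_le_mul_of_nonneg_left (by exact_mod_cast hA h hh) hκ
  rw [expectation_sub, expectation_const, expectation_mul_const, ← toReal_bind_apply] at h2
  change _ ≤ Real.log (1 + (A.estimateLaw lam B G).toReal * (M - 1)) at h1
  change (A.estimateLaw lam G G).toReal * Real.log M - κ * n ≤ _ at h2
  set y := 1 + (A.estimateLaw lam B G).toReal * (M - 1) with hy
  have hy0 : 0 < y :=
    add_pos_of_pos_of_nonneg one_pos (mul_nonneg ENNReal.toReal_nonneg (by linarith))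
  -- The tangent of log at 2 makes the bound linear in the probability under `B`, ready for
  -- summation over `G`.
  have h3 := Real.log_le_sub_one_of_pos (half_pos hy0)
  rw [Real.log_div hy0.ne' two_ne_zero] at h3
  linarith

/-! ## The ensemble -/

theorem mem_ensemble2a {p L : ℕ} {c : Fin p → Fin L} {G : SimpleGraph (Fin p)} :
    G ∈ ensemble2a c ↔ ∃ e : Fin L → Sym2 (Fin p),
      (∀ j, e j ∈ (cliqueUnion c).edgeSet ∧ ∀ v ∈ e j, c v = j) ∧
        G = (cliqueUnion c).deleteEdges (Set.range e) := by
  simp [ensemble2a]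

theorem ensemble2a_nonempty {p L : ℕ} {c : Fin p → Fin L}
    (hc : ∀ j, 2 ≤ (Finset.univ.filter fun v => c v = j).card) : (ensemble2a c).Nonempty := by
  have h (j) : ∃ e ∈ (cliqueUnion c).edgeSet, ∀ v ∈ e, c v = j := by
    obtain ⟨a, ha, b, hb, hab⟩ := Finset.one_lt_card.1 (hc j)
    simp only [Finset.mem_filter, Finset.mem_univ, true_and] at ha hb
    refine ⟨s(a, b), ⟨hab, ha.trans hb.symm⟩, fun v hv => ?_⟩
    rcases Sym2.mem_iff.1 hv with rfl | rfl <;> assumption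
  choose e he using h
  exact ⟨_, mem_ensemble2a.2 ⟨e, he, rfl⟩⟩

/-- The clique on `C`, the other nodes being isolated. -/
def cliqueOn {p : ℕ} (C : Finset (Fin p)) : SimpleGraph (Fin p) where
  Adj a b := a ≠ b ∧ a ∈ C ∧ b ∈ C
  symm := ⟨fun _ _ h => ⟨h.1.symm, h.2.2, h.2.1⟩⟩
  loopless := ⟨fun _ h => h.1 rfl⟩

theorem exists_removed_edge {p L : ℕ} {c : Fin p → Fin L} {G : SimpleGraph (Fin p)}
    (hG : G ∈ ensemble2a c) {j : Fin L} {C : Finset (Fin p)} (hC : ∀ a, a ∈ C ↔ c a = j) :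
    ∃ u v, u ≠ v ∧ u ∈ C ∧ v ∈ C ∧ ¬ G.Adj u v ∧ (∀ a b, G.Adj a b → (a ∈ C ↔ b ∈ C)) ∧
      ∀ a ∈ C, ∀ b ∈ C, a ≠ b → s(a, b) ≠ s(u, v) → G.Adj a b := by
  obtain ⟨e, he, rfl⟩ := mem_ensemble2a.1 hG
  obtain ⟨⟨u, v⟩, huv⟩ := Quot.exists_rep (e j)
  change s(u, v) = e j at huv
  have hej := he j
  rw [← huv, SimpleGraph.mem_edgeSet] at hej
  refine ⟨u, v, hej.1.1, (hC u).2 (hej.2 u (by simp)), (hC v).2 (hej.2 v (by simp)), ?_, ?_, ?_⟩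
  · rw [SimpleGraph.deleteEdges_adj]
    exact fun h => h.2 ⟨j, huv.symm⟩
  · intro a b hab
    rw [SimpleGraph.deleteEdges_adj] at hab
    rw [hC, hC, hab.1.2]
  · intro a ha b hb hab hne
    rw [SimpleGraph.deleteEdges_adj]
    refine ⟨⟨hab, ((hC a).1 ha).trans ((hC b).1 hb).symm⟩, ?_⟩
    rintro ⟨i, hi⟩
    have hij : i = j := ((he i).2 a (by simp [hi])).symm.trans ((hC a).1 ha)
    exact hne (hi.symm.trans (by rw [hij, huv]))

theorem sup_deleteEdges_mem_ensemble2a {p L : ℕ} {c : Fin p → Fin L} {G : SimpleGraph (Fin p)}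
    (hG : G ∈ ensemble2a c) {j : Fin L} {C : Finset (Fin p)} (hC : ∀ a, a ∈ C ↔ c a = j)
    {a b : Fin p} (ha : a ∈ C) (hb : b ∈ C) (hab : a ≠ b) :
    (G ⊔ cliqueOn C).deleteEdges {s(a, b)} ∈ ensemble2a c := by
  classical
  obtain ⟨e, he, rfl⟩ := mem_ensemble2a.1 hG
  refine mem_ensemble2a.2 ⟨Function.update e j s(a, b), fun i => ?_, ?_⟩
  · rcases eq_or_ne i j with rfl | hij
    · rw [Function.update_self]
      refine ⟨⟨hab, ((hC a).1 ha).trans ((hC b).1 hb).symm⟩, fun v hv => ?_⟩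
      rcases Sym2.mem_iff.1 hv with rfl | rfl
      · exact (hC _).1 ha
      · exact (hC _).1 hb
    · rw [Function.update_of_ne hij]
      exact he i
  · ext w z
    simp only [SimpleGraph.deleteEdges_adj, SimpleGraph.sup_adj, Set.mem_singleton_iff]
    constructor
    · rintro ⟨h | h, hne⟩
      · refine ⟨h.1, ?_⟩
        rintro ⟨i, hi⟩
        rcases eq_or_ne i j with rfl | hij
        · exact hne (by rw [← hi, Function.update_self])
        · exact h.2 ⟨i, by rw [← hi, Function.update_of_ne hij]⟩
      · refine ⟨⟨h.1, ((hC w).1 h.2.1).trans ((hC z).1 h.2.2).symm⟩, ?_⟩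
        rintro ⟨i, hi⟩
        rcases eq_or_ne i j with rfl | hij
        · exact hne (by rw [← hi, Function.update_self])
        · rw [Function.update_of_ne hij] at hi
          exact hij (((he i).2 w (by simp [hi])).symm.trans ((hC w).1 h.2.1))
    · rintro ⟨h, hne⟩
      refine ⟨?_, fun hs => hne ⟨j, by rw [hs, Function.update_self]⟩⟩
      by_cases hw : w ∈ C
      · exact Or.inr ⟨h.1, hw, (hC z).2 (h.2.symm.trans ((hC w).1 hw))⟩
      · refine Or.inl ⟨h, ?_⟩
        rintro ⟨i, hi⟩
        have hij : i ≠ j := by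
          rintro rfl
          exact hw ((hC w).2 ((he i).2 w (by simp [hi])))
        exact hne ⟨i, by rw [Function.update_of_ne hij, hi]⟩

theorem deleteEdges_sup_cliqueOn {p : ℕ} (G : SimpleGraph (Fin p)) {C : Finset (Fin p)}
    {a b : Fin p} (ha : a ∈ C) (hb : b ∈ C) :
    (G ⊔ cliqueOn C).deleteEdges {s(a, b)} ⊔ cliqueOn C = G ⊔ cliqueOn C := by
  refine le_antisymm (sup_le (SimpleGraph.deleteEdges_le _) le_sup_right) fun w z h => ?_
  by_cases hs : s(w, z) = s(a, b)
  · refine Or.inr ⟨h.ne, ?_⟩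
    rcases Sym2.eq_iff.1 hs with ⟨rfl, rfl⟩ | ⟨rfl, rfl⟩ <;> exact ⟨by assumption, by assumption⟩
  · exact Or.inl (SimpleGraph.deleteEdges_adj.2 ⟨h, hs⟩)

-- Restoring the edge of `C` and deleting any other pair of `C` stays in the ensemble and in the
-- fiber; distinct pairs give distinct graphs.
open Classical in
theorem choose_two_le_card_fiber {p L : ℕ} {c : Fin p → Fin L} {G : SimpleGraph (Fin p)}
    (hG : G ∈ ensemble2a c) {j : Fin L} {C : Finset (Fin p)} (hC : ∀ a, a ∈ C ↔ c a = j) :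
    C.card.choose 2 ≤
      ((ensemble2a c).filter fun H => H ⊔ cliqueOn C = G ⊔ cliqueOn C).card := by
  rw [← Sym2.card_image_offDiag]
  refine Finset.card_le_card_of_injOn (fun s => (G ⊔ cliqueOn C).deleteEdges {s}) ?_ ?_
  · intro s hs
    obtain ⟨⟨a, b⟩, hab, rfl⟩ := Finset.mem_image.1 hs
    obtain ⟨ha, hb, hne⟩ := Finset.mem_offDiag.1 hab
    exact Finset.mem_filter.2 ⟨sup_deleteEdges_mem_ensemble2a hG hC ha hb hne,
      deleteEdges_sup_cliqueOn G ha hb⟩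
  · intro s hs t ht hst
    obtain ⟨⟨a, b⟩, hab, rfl⟩ := Finset.mem_image.1 hs
    obtain ⟨ha, hb, hne⟩ := Finset.mem_offDiag.1 hab
    by_contra hsne
    have h : ((G ⊔ cliqueOn C).deleteEdges {t}).Adj a b :=
      SimpleGraph.deleteEdges_adj.2 ⟨Or.inr ⟨hne, ha, hb⟩, hsne⟩
    rw [← show (G ⊔ cliqueOn C).deleteEdges {s(a, b)} = (G ⊔ cliqueOn C).deleteEdges {t} from hst]
      at h
    exact (SimpleGraph.deleteEdges_adj.1 h).2 rfl

/-- The lower bound on the number of observations in terms of a single clique. -/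
theorem one_sub_mul_log_choose_le {p L : ℕ} {c : Fin p → Fin L}
    (hc : ∀ j, 2 ≤ (Finset.univ.filter fun v => c v = j).card) {lam : ℝ} (hlam : 0 ≤ lam)
    {n N : ℕ} (A : Learner p N) (hA : ∀ G ∈ ensemble2a c, A.WithinBudget lam G n)
    {δ : ℝ} (hδ : A.avgErrorProb lam (ensemble2a c) ≤ δ)
    {j : Fin L} {C : Finset (Fin p)} (hC : ∀ a, a ∈ C ↔ c a = j)
    {r : ℕ} (hr1 : 1 ≤ r) (hr : C.card = r + 2) :
    (1 - δ) * Real.log ((r + 2).choose 2 : ℝ) ≤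
      lam * ((r + 1) * Real.exp (-(lam * r))) * n + Real.log 2 := by
  classical
  set κ := lam * ((r + 1) * Real.exp (-(lam * r))) with hκ
  set T := ensemble2a c with hT
  set M : ℝ := ((r + 2).choose 2 : ℝ) with hMdef
  have hM : 1 ≤ M := by
    rw [hMdef]
    exact_mod_cast Nat.choose_pos (n := r + 2) (k := 2) (by omega)
  have hκ0 : 0 ≤ κ := by positivity
  have hTpos : (0 : ℝ) < T.card := by exact_mod_cast (ensemble2a_nonempty hc).card_pos
  have hG (G) (hGT : G ∈ T) : (A.estimateLaw lam G G).toReal * Real.log M ≤ κ * n + Real.log 2 +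
      ((A.estimateLaw lam (G ⊔ cliqueOn C) G).toReal * (M - 1) - 1) / 2 := by
    obtain ⟨u, v, huv, hu, hv, hnadj, hout, hin⟩ := exists_removed_edge hGT hC
    have hB (a b) : (G ⊔ cliqueOn C).Adj a b ↔ G.Adj a b ∨ s(a, b) = s(u, v) := by
      rw [SimpleGraph.sup_adj]
      constructor
      · rintro (h | h)
        · exact Or.inl h
        · by_cases hs : s(a, b) = s(u, v)
          · exact Or.inr hs
          · exact Or.inl (hin a h.2.1 b h.2.2 h.1 hs)
      · rintro (h | h)
        · exact Or.inl h
        · rcases Sym2.eq_iff.1 h with ⟨rfl, rfl⟩ | ⟨rfl, rfl⟩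
          · exact Or.inr ⟨huv, hu, hv⟩
          · exact Or.inr ⟨huv.symm, hv, hu⟩
    refine estimateLaw_mul_log_le A hκ0 hM ?_ (hA G hGT)
    exact expectation_observe_le hlam (edgeSum_eq_add huv hnadj hB)
      (mul_le_mul_of_nonneg_left (expectation_ne_le hlam huv hu hv hout hin hr1 hr) hlam)
  set I := T.image fun G => G ⊔ cliqueOn C with hI
  have hmaps (G) (hGT : G ∈ T) : G ⊔ cliqueOn C ∈ I := Finset.mem_image_of_mem _ hGT
  -- On each fiber `B` is fixed, so the terms are probabilities of distinct outputs under one law.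
  have hq : ∑ G ∈ T, (A.estimateLaw lam (G ⊔ cliqueOn C) G).toReal ≤ I.card := by
    rw [← Finset.sum_fiberwise_of_maps_to hmaps, Finset.card_eq_sum_ones, Nat.cast_sum]
    refine Finset.sum_le_sum fun B _ => ?_
    rw [Nat.cast_one, ← sum_toReal (A.estimateLaw lam B)]
    refine (Finset.sum_congr rfl fun G hGB => ?_).trans_le
      (Finset.sum_le_sum_of_subset_of_nonneg (Finset.subset_univ _)
        fun G _ _ => ENNReal.toReal_nonneg)
    · rw [(Finset.mem_filter.1 hGB).2]
  have hcard : M * I.card ≤ T.card := by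
    have : I.card * (r + 2).choose 2 ≤ T.card := by
      rw [Finset.card_eq_sum_card_fiberwise hmaps, ← smul_eq_mul, ← Finset.sum_const]
      refine Finset.sum_le_sum fun B hB => ?_
      obtain ⟨G, hGT, rfl⟩ := Finset.mem_image.1 hB
      rw [← hr]
      exact choose_two_le_card_fiber hGT hC
    rw [mul_comm, hMdef]
    exact_mod_cast this
  have hsum := Finset.sum_le_sum hG
  rw [← Finset.sum_mul, Finset.sum_add_distrib, Finset.sum_const, ← Finset.sum_div,
    Finset.sum_sub_distrib, ← Finset.sum_mul, Finset.sum_const, nsmul_eq_mul, nsmul_eq_mul,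
    mul_one] at hsum
  rw [Learner.avgErrorProb, div_le_iff₀ hTpos] at hδ
  simp only [errorProb_eq] at hδ
  rw [Finset.sum_sub_distrib, Finset.sum_const, nsmul_eq_mul, mul_one] at hδ
  have hlog : 0 ≤ Real.log M := Real.log_nonneg hM
  have h1 := mul_le_mul_of_nonneg_right hq (sub_nonneg.2 hM)
  have h2 : ((T.card : ℝ) * (1 - δ)) * Real.log M ≤
      (∑ G ∈ T, (A.estimateLaw lam G G).toReal) * Real.log M :=
    mul_le_mul_of_nonneg_right (by linarith) hlog
  have h3 : (0 : ℝ) ≤ I.card := Nat.cast_nonneg _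
  refine le_of_mul_le_mul_left ?_ hTpos
  linarith

/-- With x = log d, y = log(d+1), b = log 2 and 1-δ = t + b/y, the inequality (b/y)(x+y-b) ≥ b
absorbs the additive log 2. Then x+y ≤ 2(x+y-b) accounts for the factor 2 in the denominator. -/
theorem fano_bound_le {d lam δ n : ℝ} (hd : 2 ≤ d) (hlam : 0 < lam) (hn : 0 ≤ n)
    (h : (1 - δ) * Real.log ((d + 1) * d / 2) ≤
      lam * (d * Real.exp (-(lam * (d - 1)))) * n + Real.log 2) :
    Real.exp (lam * d) * Real.log (d * (d + 1)) / (2 * lam * d * Real.exp lam) *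
      (1 - δ - Real.log 2 / Real.log (d + 1)) ≤ n := by
  have hd0 : 0 < d := by linarith
  set κ := lam * (d * Real.exp (-(lam * (d - 1)))) with hκ
  have hκ0 : 0 < κ := by positivity
  set x := Real.log d with hx
  set y := Real.log (d + 1) with hy
  set b := Real.log 2 with hb
  have hb0 : 0 < b := Real.log_pos one_lt_two
  have hbx : b ≤ x := Real.log_le_log two_pos hd
  have hxy : x ≤ y := Real.log_le_log hd0 (by linarith)
  have hy0 : 0 < y := by linarith
  have hxy' : Real.log (d * (d + 1)) = x + y := Real.log_mul hd0.ne' (by linarith)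
  have hM : Real.log ((d + 1) * d / 2) = x + y - b := by
    rw [Real.log_div (by positivity) two_ne_zero, mul_comm, hxy']
  have hcoef : Real.exp (lam * d) * (x + y) / (2 * lam * d * Real.exp lam) =
      (x + y) / (2 * κ) := by
    have : Real.exp (-(lam * (d - 1))) = Real.exp lam / Real.exp (lam * d) := by
      rw [← Real.exp_sub]
      congr 1
      ring
    rw [hκ, this]
    field_simp
  rw [hM] at h
  rw [hxy', hcoef]
  set t := 1 - δ - b / y with ht
  rcases le_or_gt t 0 with ht0 | ht0
  · exact (mul_nonpos_of_nonneg_of_nonpos (div_nonneg (by linarith) (by positivity)) ht0).trans hn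
  · rw [div_mul_eq_mul_div, div_le_iff₀ (by positivity)]
    have hδ : 1 - δ = t + b / y := by rw [ht]; ring
    have hby : b / y * y = b := div_mul_cancel₀ _ hy0.ne'
    have hby0 : 0 < b / y := by positivity
    rw [hδ] at h
    have hkey : 0 ≤ b / y * (x - b) := mul_nonneg hby0.le (by linarith)
    nlinarith [mul_nonneg ht0.le (by linarith : (0 : ℝ) ≤ x + y - 2 * b)]

theorem avgErrorProb_nonneg {p N : ℕ} (A : Learner p N) (lam : ℝ)
    (T : Finset (SimpleGraph (Fin p))) : 0 ≤ A.avgErrorProb lam T :=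
  div_nonneg (Finset.sum_nonneg fun _ _ => ENNReal.toReal_nonneg) (Nat.cast_nonneg _)

end ActiveLearning

theorem mainTheorem4 (p L : ℕ) (hL : 0 < L) (m : Fin L → ℕ) (hm : ∀ j, 2 ≤ m j)
    (hsum : ∑ j, m j = p) (c : Fin p → Fin L)
    (hc : ∀ j, (Finset.univ.filter fun v => c v = j).card = m j)
    (lam : ℝ) (hlam : 0 < lam) (n N : ℕ) (A : ActiveLearning.Learner p N)
    (hA : ∀ G ∈ ActiveLearning.ensemble2a c, A.WithinBudget lam G n)
    (δ : ℝ) (hδ : A.avgErrorProb lam (ActiveLearning.ensemble2a c) ≤ δ) :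
    Real.exp (lam * (ActiveLearning.dmax m : ℝ))
          * Real.log ((ActiveLearning.dmax m : ℝ) * ((ActiveLearning.dmax m : ℝ) + 1))
        / (2 * lam * (ActiveLearning.dmax m : ℝ) * Real.exp lam)
        * (1 - δ - Real.log 2 / Real.log ((ActiveLearning.dmax m : ℝ) + 1))
      ≤ (n : ℝ) := by

  obtain ⟨j, -, hj⟩ := Finset.exists_mem_eq_sup Finset.univ
    (Finset.univ_nonempty_iff.2 ⟨(⟨0, hL⟩ : Fin L)⟩) m
  set d := ActiveLearning.dmax m with hd
  have hdj : d = m j - 1 := by rw [hd, ActiveLearning.dmax, hj]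
  have hmj := hm j
  have hδ0 : 0 ≤ δ := (ActiveLearning.avgErrorProb_nonneg A lam _).trans hδ
  -- For d = 1 the last factor is 1 - δ - 1 ≤ 0, so the bound is trivial.
  rcases (show 1 ≤ d by omega).eq_or_lt with hd1 | hd2
  · rw [← hd1]
    refine le_trans (mul_nonpos_of_nonneg_of_nonpos ?_ ?_) (Nat.cast_nonneg n)
    · have : 0 ≤ Real.log (((1 : ℕ) : ℝ) * (((1 : ℕ) : ℝ) + 1)) := Real.log_nonneg (by norm_num)
      positivity
    · have : Real.log (((1 : ℕ) : ℝ) + 1) = Real.log 2 := by norm_num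
      rw [this, div_self (Real.log_pos one_lt_two).ne']
      linarith
  · obtain ⟨r, hr⟩ : ∃ r, d = r + 1 := ⟨d - 1, by omega⟩
    have h := ActiveLearning.one_sub_mul_log_choose_le (fun i => (hc i).symm ▸ hm i) hlam.le A hA
      hδ (j := j) (C := Finset.univ.filter fun v => c v = j) (fun a => by simp) (r := r)
      (by omega) (by rw [hc]; omega)
    refine ActiveLearning.fano_bound_le (by exact_mod_cast hd2) hlam (Nat.cast_nonneg n) ?_
    rw [Nat.cast_choose_two] at h
    rw [hr]
    convert h using 3
    · push_cast
      congr 1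
      ring
    · push_cast
      ring_nf
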